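/- Let $Q$ be a fine monoid, i.e. a commutative monoid (written additively) that is finitely generated and integral ($m+n=p+n$ implies $m=p$), regarded as a submonoid of its universal group $Q^{gp}$. Let $Q^{*}$ be its group of units and let $Q^{sat}=\{x\in Q^{gp}: nx\in Q \text{ for some integer } n\ge 1\}$. A prime ideal of $Q$ is a proper subset $\mathfrak p\subsetneq Q$ (possibly empty) such that $q\in\mathfrak p,\ k\in Q$ imply $q+k\in\mathfrak p$, and $q+k\in\mathfrak p$ implies $q\in\mathfrak p$ or $k\in\mathfrak p$; its height $ht(\mathfrak p)$ is the maximal length $h$ of a strict chain of prime ideals $\mathfrak p_h\subsetneq\cdots\subsetneq\mathfrak p_0=\mathfrak p$. Put $$Q_{\mathfrak p}=\{q-t : q\in Q,\ t\in Q\setminus\mathfrak p\}\subseteq Q^{gp},\qquad Q^{sat}_{\mathfrak p}=\{x-t : x\in Q^{sat},\ t\in Q\setminus\mathfrak p\}\subseteq Q^{gp}.$$ A monoid $M$ is called valuative if it is integral and for every $x\in M^{gp}$ one has $x\in M$ or $-x\in M$; it is called saturated if it is integral and $x\in M^{gp}$, $nx\in M$ for some integer $n\ge1$ imply $x\in M$.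 (1) For every prime ideal $\mathfrak p$ of $Q$ of height one, the monoid $Q^{sat}_{\mathfrak p}$ is valuative, and there is a unique epimorphism of groups $v_{\mathfrak p}:Q^{gp}\to\mathbb Z$ such that $v_{\mathfrak p}^{-1}(\{1,2,3,\dots\})\cap Q=\mathfrak p$. Moreover $Q^{sat}_{\mathfrak p}=\{x\in Q^{gp}: v_{\mathfrak p}(x)\ge 0\}$. (2) If moreover $Q$ is saturated, then $$Q=\{x\in Q^{gp}: v_{\mathfrak p}(x)\ge 0 \text{ for all prime ideals } \mathfrak p \text{ with } ht(\mathfrak p)=1\},$$ $$Q^{*}=\{x\in Q^{gp}: v_{\mathfrak p}(x)= 0 \text{ for all prime ideals } \mathfrak p \text{ with } ht(\mathfrak p)=1\}.$$ In particular $Q=\bigcap_{ht(\mathfrak p)=1}Q_{\mathfrak p}$, the intersection being taken in $Q^{gp}$ (and equal to $Q^{gp}$ if there is no prime of height one). -/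

import Mathlib

namespace MonoidVal

open Algebra

/-- A commutative monoid is fine if it is integral (cancellative) and finitely generated. -/
structure IsFine (Q : Type*) [AddCommMonoid Q] : Prop where
  integral : IsCancelAdd Q
  fg : AddMonoid.FG Q

/-- The canonical map `Q → Q^gp` into the universal abelian group. -/
abbrev toGp (Q : Type*) [AddCommMonoid Q] : Q →+ GrothendieckAddGroup Q :=
  GrothendieckAddGroup.of

/-- The image of `Q` in `Q^gp`. -/
abbrev inGp (Q : Type*) [AddCommMonoid Q] : AddSubmonoid (GrothendieckAddGroup Q) :=
  AddMonoidHom.mrange (toGp Q)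

/-- `Q` is saturated if it is integral and, for all `x ∈ Q^gp` and `n > 0`, `n x ∈ Q` implies
`x ∈ Q`. -/
structure IsSaturated (Q : Type*) [AddCommMonoid Q] : Prop where
  integral : IsCancelAdd Q
  saturated : ∀ (x : GrothendieckAddGroup Q) (n : ℕ), 0 < n → n • x ∈ inGp Q → x ∈ inGp Q

/-- `M` is valuative if it is integral and, for all `x ∈ M^gp`, `x ∈ M` or `-x ∈ M`. -/
structure IsValuative (M : Type*) [AddCommMonoid M] : Prop where
  integral : IsCancelAdd M
  mem_or_neg_mem : ∀ x : GrothendieckAddGroup M, x ∈ inGp M ∨ -x ∈ inGp M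

/-- The saturation `Q^sat = {x ∈ Q^gp : n x ∈ Q for some n > 0}`. -/
def sat (Q : Type*) [AddCommMonoid Q] : AddSubmonoid (GrothendieckAddGroup Q) where
  carrier := {x | ∃ n : ℕ, 0 < n ∧ n • x ∈ inGp Q}
  zero_mem' := ⟨1, one_pos, by rw [smul_zero]; exact zero_mem _⟩
  add_mem' := by
    rintro x y ⟨m, hm, hx⟩ ⟨n, hn, hy⟩
    refine ⟨m * n, Nat.mul_pos hm hn, ?_⟩
    have h : (m * n) • (x + y) = n • (m • x) + m • (n • y) := by
      rw [smul_add, mul_smul, mul_smul, smul_comm]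
    rw [h]
    exact add_mem (nsmul_mem hx n) (nsmul_mem hy m)

/-- An ideal `I` of the monoid `Q` (possibly empty) is prime if `I ≠ Q` and `q + k ∈ I` implies
`q ∈ I` or `k ∈ I`. -/
structure IsPrimeIdeal {Q : Type*} [AddCommMonoid Q] (I : AddSemigroupIdeal Q) : Prop where
  ne_univ : (I : Set Q) ≠ Set.univ
  mem_or_mem : ∀ q k : Q, q + k ∈ I → q ∈ I ∨ k ∈ I

/-- The set of prime ideals of `Q`, ordered by inclusion. -/
abbrev Spec (Q : Type*) [AddCommMonoid Q] : Type _ :=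
  {I : AddSemigroupIdeal Q // IsPrimeIdeal I}

/-- The prime ideals of height one: the longest chains `𝔭_h ⊂ ⋯ ⊂ 𝔭_0 = 𝔭` of prime ideals
have `h = 1`. -/
abbrev HeightOne (Q : Type*) [AddCommMonoid Q] : Type _ :=
  {p : Spec Q // Order.height p = 1}

/-- The face `Q ∖ 𝔭` complementary to a prime ideal `𝔭`. -/
def face {Q : Type*} [AddCommMonoid Q] (p : Spec Q) : AddSubmonoid Q where
  carrier := {q | q ∉ p.1}
  zero_mem' := fun h => p.2.ne_univ <| Set.eq_univ_of_forall fun q => by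
    have := AddSemigroupIdeal.add_mem p.1 q h
    rwa [add_zero] at this
  add_mem' := fun {a b} ha hb h => (p.2.mem_or_mem a b h).elim ha hb

/-- The localization of a submonoid `M` of an abelian group at a submonoid `T` of `M`,
inside that group: the submonoid of all differences `m - t` with `m ∈ M` and `t ∈ T`. -/
def localize {G : Type*} [AddCommGroup G] (M T : AddSubmonoid G) : AddSubmonoid G where
  carrier := {x | ∃ m ∈ M, ∃ t ∈ T, x = m - t}
  zero_mem' := ⟨0, zero_mem M, 0, zero_mem T, (sub_zero 0).symm⟩
  add_mem' := by
    rintro _ _ ⟨m, hm, t, ht, rfl⟩ ⟨m', hm', t', ht', rfl⟩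
    exact ⟨m + m', add_mem hm hm', t + t', add_mem ht ht', by abel⟩

/-- `Q_𝔭` for integral `Q`, as a submonoid of `Q^gp`: the localization of `Q` at `Q ∖ 𝔭`. -/
def loc {Q : Type*} [AddCommMonoid Q] (p : Spec Q) : AddSubmonoid (GrothendieckAddGroup Q) :=
  localize (inGp Q) ((face p).map (toGp Q))

/-- `Q^sat_𝔭` for integral `Q`, as a submonoid of `Q^gp`: the localization of `Q^sat` at the image
of `Q ∖ 𝔭`. -/
def satLoc {Q : Type*} [AddCommMonoid Q] (p : Spec Q) : AddSubmonoid (GrothendieckAddGroup Q) :=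
  localize (sat Q) ((face p).map (toGp Q))

/-- `v : Q^gp → ℤ` is an epimorphism of groups with `v⁻¹(ℕ⁺) ∩ Q = 𝔭`. -/
structure IsValuationAt {Q : Type*} [AddCommMonoid Q] (p : Spec Q)
    (v : GrothendieckAddGroup Q →+ ℤ) : Prop where
  surjective : Function.Surjective v
  pos_iff : ∀ q : Q, 0 < v (toGp Q q) ↔ q ∈ p.1

end MonoidVal

/-! This is duality for rational cones. A homomorphism `Q^gp → ℤ` that is nonnegative on `Q` is
positive exactly on a prime ideal, its support. An integral Farkas lemma
(`exists_nsmul_mem_closure`) shows that such homomorphisms cut out `Q^sat`, that those vanishing off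
`𝔭` cut out `Q^sat_𝔭`, and that every prime is a support.

Given two such homomorphisms `v` and `w` with `w ≠ 0`, `exists_min_ratio` subtracts from `v` the
largest multiple of `w` that keeps it nonnegative on `Q`, and so removes an element from the
support. If both have the same height one support, minimality makes the difference zero: they are
proportional. This gives uniqueness and the half-space description of `Q^sat_𝔭`. For larger
supports, the same subtraction drives a descent (`exists_heightOne_neg`): a homomorphism negative at
`x` can be replaced by one with height one support. Hence the height one valuations already cut out
a saturated `Q`. -/

namespace MonoidVal

open Algebra

/-! ### Integral Farkas lemma and homomorphisms to `ℤ` -/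

section Farkas

variable {G : Type*} [AddCommGroup G]

/-- In a finitely generated abelian group, the homomorphisms to `ℤ` detect torsion. -/
theorem exists_pos_nsmul_eq_zero [Module.Finite ℤ G] (x : G) (h : ∀ v : G →+ ℤ, v x = 0) :
    ∃ n : ℕ, 0 < n ∧ n • x = 0 := by
  have hfree : Module.Free ℤ (G ⧸ Submodule.torsion ℤ G) :=
    Module.free_of_finite_type_torsion_free'
  have hx : (Submodule.torsion ℤ G).mkQ x = 0 := by
    rw [← Module.forall_dual_apply_eq_zero_iff ℤ]
    exact fun f => h (f.comp (Submodule.torsion ℤ G).mkQ).toAddMonoidHom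
  rw [Submodule.mkQ_apply, Submodule.Quotient.mk_eq_zero, Submodule.mem_torsion_iff] at hx
  obtain ⟨⟨a, ha⟩, hax⟩ := hx
  replace hax : a • x = 0 := hax
  refine ⟨a.natAbs, Int.natAbs_pos.2 (nonZeroDivisors.ne_zero ha), ?_⟩
  rw [← natCast_zsmul]
  rcases Int.natAbs_eq a with h' | h'
  · rw [← h', hax]
  · rw [← neg_eq_iff_eq_neg.2 h', neg_smul, hax, neg_zero]

/-- **Farkas' lemma** over the integers: an element on which all homomorphisms to `ℤ` nonnegative
on a finite list take nonnegative values has a positive multiple in the monoid generated by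
the list. -/
theorem exists_nsmul_mem_closure [Module.Finite ℤ G] (l : List G) (x : G)
    (h : ∀ v : G →+ ℤ, (∀ s ∈ l, 0 ≤ v s) → 0 ≤ v x) :
    ∃ n : ℕ, 0 < n ∧ n • x ∈ AddSubmonoid.closure {y | y ∈ l} := by
  induction hk : l.length generalizing l x with
  | zero =>
    obtain rfl := List.length_eq_zero_iff.1 hk
    obtain ⟨n, hn, hx⟩ := exists_pos_nsmul_eq_zero x fun v =>
      le_antisymm (by simpa using h (-v) (by simp)) (h v (by simp))
    exact ⟨n, hn, hx ▸ zero_mem _⟩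
  | succ k ih =>
    obtain ⟨a, l, rfl⟩ := List.exists_cons_of_length_eq_add_one hk
    have hmono : AddSubmonoid.closure {y | y ∈ l} ≤ AddSubmonoid.closure {y | y ∈ a :: l} :=
      AddSubmonoid.closure_mono fun y hy => List.mem_cons_of_mem a hy
    have hsub : ∀ y ∈ a :: l, y ∈ AddSubmonoid.closure {y | y ∈ a :: l} := fun y hy =>
      AddSubmonoid.subset_closure hy
    by_cases hl : ∀ v : G →+ ℤ, (∀ s ∈ l, 0 ≤ v s) → 0 ≤ v x
    · obtain ⟨n, hn, hx⟩ := ih l x hl (by simpa using hk)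
      exact ⟨n, hn, hmono hx⟩
    push Not at hl
    obtain ⟨u, hu, hux⟩ := hl
    have hua : u a < 0 := by
      by_contra! hua
      exact absurd (h u (List.forall_mem_cons.2 ⟨hua, hu⟩)) (not_le.2 hux)
    -- the projection along `a` onto the kernel of `u`
    let π : G → G := fun y => (-u a) • y + u y • a
    obtain ⟨n, hn, hx⟩ := ih (l.map π) (π x) (fun v hv => by
      -- `w` is `v ∘ π`; it kills `a`, so it is nonnegative on the whole list.
      let w : G →+ ℤ := (-u a) • v + (v a) • u
      have hw : ∀ y, w y = v (π y) := fun y => by simp [w, π, mul_comm]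
      rw [← hw]
      refine h w (List.forall_mem_cons.2 ⟨?_, fun s hs => ?_⟩)
      · simp [w, mul_comm]
      · rw [hw]
        exact hv _ (List.mem_map_of_mem hs)) (by simpa using hk)
    obtain ⟨c, hc⟩ := Int.eq_ofNat_of_zero_le (neg_nonneg.2 hua.le)
    obtain ⟨d, hd⟩ := Int.eq_ofNat_of_zero_le (neg_nonneg.2 hux.le)
    have hc0 : 0 < c := by omega
    have hmem : ∀ y ∈ AddSubmonoid.closure {y | y ∈ l.map π},
        y ∈ AddSubmonoid.closure {y | y ∈ a :: l} := by
      intro y hy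
      refine AddSubmonoid.closure_le.2 (fun y hy => ?_) hy
      obtain ⟨s, hs, rfl⟩ := List.mem_map.1 hy
      obtain ⟨e, he⟩ := Int.eq_ofNat_of_zero_le (hu s hs)
      have : π s = c • s + e • a := by simp only [π, hc, he, natCast_zsmul]
      rw [SetLike.mem_coe, this]
      exact add_mem (nsmul_mem (hsub s (List.mem_cons_of_mem a hs)) c)
        (nsmul_mem (hsub a List.mem_cons_self) e)
    refine ⟨n * c, Nat.mul_pos hn hc0, ?_⟩
    -- `π x = c x - d a` with `d ≥ 0` because `u x < 0`; moving `a` across leaves nonnegative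
    -- coefficients only.
    have : (n * c) • x = n • π x + (n * d) • a := by
      have hux' : u x = -(d : ℤ) := by rw [← hd, neg_neg]
      simp only [π, hc, hux', natCast_zsmul, neg_smul, smul_add, smul_neg, mul_smul]
      abel
    rw [this]
    exact add_mem (hmem _ hx) (nsmul_mem (hsub a List.mem_cons_self) _)

/-- A nonzero homomorphism to `ℤ` is a positive multiple of a surjective one. -/
theorem exists_surjective_mul {v : G →+ ℤ} (hv : v ≠ 0) :
    ∃ (w : G →+ ℤ) (d : ℤ), 0 < d ∧ Function.Surjective w ∧ ∀ x, v x = d * w x := by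
  obtain ⟨d, hd⟩ : ∃ d : ℤ, v.range = AddSubgroup.zmultiples |d| := by
    obtain ⟨d, hd⟩ := Int.subgroup_cyclic v.range
    refine ⟨d, AddSubgroup.ext fun x => ?_⟩
    rw [hd, ← AddSubgroup.zmultiples_eq_closure, Int.mem_zmultiples_iff, Int.mem_zmultiples_iff,
      abs_dvd]
  have hdvd : ∀ x, |d| ∣ v x := fun x => by
    rw [← Int.mem_zmultiples_iff, ← hd]
    exact ⟨x, rfl⟩
  have hd0 : 0 < |d| := by
    refine abs_pos.2 fun h0 => hv (AddMonoidHom.ext fun x => ?_)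
    simpa [h0] using hdvd x
  refine ⟨AddMonoidHom.mk' (fun x => v x / |d|) fun x y => ?_, |d|, hd0, fun n => ?_, fun x => ?_⟩
  · rw [map_add, Int.add_ediv_of_dvd_left (hdvd x)]
  · obtain ⟨x, hx⟩ : n * |d| ∈ v.range := by
      rw [hd, Int.mem_zmultiples_iff]
      exact dvd_mul_left _ _
    exact ⟨x, by simp [hx, Int.mul_ediv_cancel _ hd0.ne']⟩
  · exact (Int.mul_ediv_cancel' (hdvd x)).symm

end Farkas

section Monoid

variable {Q : Type*} [AddCommMonoid Q]

theorem exists_eq_toGp_sub (x : GrothendieckAddGroup Q) :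
    ∃ a b : Q, x = toGp Q a - toGp Q b := by
  obtain ⟨⟨a, b⟩, h⟩ := (AddLocalization.addMonoidOf (⊤ : AddSubmonoid Q)).surj x
  exact ⟨a, b, eq_sub_of_add_eq h⟩

theorem hom_eq_of_toGp {v w : GrothendieckAddGroup Q →+ ℤ}
    (h : ∀ q, v (toGp Q q) = w (toGp Q q)) : v = w := by
  ext x
  obtain ⟨a, b, rfl⟩ := exists_eq_toGp_sub x
  rw [map_sub, map_sub, h, h]

theorem finite_gp (hQ : IsFine Q) : Module.Finite ℤ (GrothendieckAddGroup Q) := by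
  have := hQ.fg
  rw [Module.Finite.iff_addGroup_fg, AddGroup.fg_iff_addMonoid_fg]
  infer_instance

theorem IsFine.exists_list (hQ : IsFine Q) :
    ∃ l : List Q, AddSubmonoid.closure {q | q ∈ l} = ⊤ := by
  obtain ⟨S, hS⟩ := hQ.fg.fg_top
  exact ⟨S.toList, by simpa using hS⟩

theorem list_induction {l : List Q} (hl : AddSubmonoid.closure {q | q ∈ l} = ⊤)
    {P : Q → Prop} (mem : ∀ q ∈ l, P q) (zero : P 0) (add : ∀ a b, P a → P b → P (a + b))
    (q : Q) : P q :=
  AddSubmonoid.closure_induction (motive := fun q _ => P q) mem zero (fun a b _ _ => add a b)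
    (hl ▸ AddSubmonoid.mem_top q)

/-! ### Prime ideals, height and supports -/

section Prime

variable (p : Spec Q)

theorem zero_notMem : (0 : Q) ∉ p.1 := (face p).zero_mem

theorem add_mem_iff (a b : Q) : a + b ∈ p.1 ↔ a ∈ p.1 ∨ b ∈ p.1 := by
  refine ⟨p.2.mem_or_mem a b, fun h => h.elim (fun ha => ?_) fun hb => ?_⟩
  · rw [add_comm]
    exact AddSemigroupIdeal.add_mem p.1 b ha
  · exact AddSemigroupIdeal.add_mem p.1 a hb

theorem nsmul_mem_iff {n : ℕ} (hn : 0 < n) (a : Q) : n • a ∈ p.1 ↔ a ∈ p.1 := by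
  induction n, hn using Nat.le_induction with
  | base => simp
  | succ n _ ih => rw [succ_nsmul, add_mem_iff, ih, or_self]

end Prime

theorem spec_ext {p p' : Spec Q} (h : ∀ q, q ∈ p.1 ↔ q ∈ p'.1) : p = p' :=
  Subtype.ext (SetLike.ext h)

/-- The empty prime ideal. -/
def emptyPrime (Q : Type*) [AddCommMonoid Q] : Spec Q :=
  ⟨⟨∅, fun _ _ h => h.elim⟩, fun h => (Set.ext_iff.1 h 0).2 trivial,
    fun _ _ h => h.elim⟩

theorem emptyPrime_le (p : Spec Q) : emptyPrime Q ≤ p := fun _ h => h.elim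

theorem eq_emptyPrime {p : Spec Q} (h : ∀ q, q ∉ p.1) : p = emptyPrime Q :=
  spec_ext fun q => iff_of_false (h q) id

theorem ne_emptyPrime_iff {p : Spec Q} : p ≠ emptyPrime Q ↔ ∃ q, q ∈ p.1 := by
  refine ⟨fun h => ?_, ?_⟩
  · by_contra! h'
    exact h (eq_emptyPrime h')
  · rintro ⟨q, hq⟩ rfl
    exact hq

/-- The empty ideal is the least prime, so height one means minimal among the nonempty primes. -/
theorem height_eq_one_iff {p : Spec Q} : Order.height p = 1 ↔
    (∃ q, q ∈ p.1) ∧ ∀ p' : Spec Q, (∃ q, q ∈ p'.1) → p' ≤ p → p' = p := by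
  have hmin : ∀ p : Spec Q, IsMin p ↔ p = emptyPrime Q := fun p =>
    ⟨fun h => le_antisymm (h (emptyPrime_le p)) (emptyPrime_le p), fun h => h ▸
      fun b _ => emptyPrime_le b⟩
  have key := Order.height_le_coe_iff (x := p) (n := 1)
  rw [Nat.cast_one] at key
  rw [le_antisymm_iff, key, Order.one_le_iff_ne_zero, Order.height_ne_zero, hmin, ← ne_eq,
    ne_emptyPrime_iff, and_comm]
  refine and_congr_right fun _ => forall_congr' fun p' => ?_
  rw [Order.lt_one_iff, Order.height_eq_zero, hmin, ← ne_emptyPrime_iff, lt_iff_le_and_ne]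
  tauto

/-- A prime is determined by the generators it contains. Finiteness makes inclusion of primes well
founded. -/
theorem IsFine.finite_spec (hQ : IsFine Q) : Finite (Spec Q) := by
  obtain ⟨l, hl⟩ := hQ.exists_list
  have : Finite {q // q ∈ l} := List.finite_toSet l
  refine Finite.of_injective (fun p : Spec Q => ({q | q.1 ∈ p.1} : Set {q // q ∈ l}))
    fun p p' h => spec_ext <| list_induction hl (fun q hq => ?_) ?_ fun a b ha hb => ?_
  · exact Set.ext_iff.1 h ⟨q, hq⟩
  · exact iff_of_false (zero_notMem p) (zero_notMem p')
  · rw [add_mem_iff, add_mem_iff, ha, hb]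

/-- `v` is nonnegative on `Q`, and `𝔭` is the set of elements on which it is positive. -/
structure IsSupport (p : Spec Q) (v : GrothendieckAddGroup Q →+ ℤ) : Prop where
  nonneg : ∀ q, 0 ≤ v (toGp Q q)
  pos_iff : ∀ q, 0 < v (toGp Q q) ↔ q ∈ p.1

theorem IsSupport.eq_zero {p : Spec Q} {v : GrothendieckAddGroup Q →+ ℤ} (hv : IsSupport p v)
    {q : Q} (hq : q ∉ p.1) : v (toGp Q q) = 0 :=
  le_antisymm (not_lt.1 fun h => hq ((hv.pos_iff q).1 h)) (hv.nonneg q)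

/-- A nonzero homomorphism which is nonnegative on `Q` is positive exactly on a prime ideal. -/
theorem exists_isSupport {v : GrothendieckAddGroup Q →+ ℤ} (hv : ∀ q, 0 ≤ v (toGp Q q)) :
    ∃ p : Spec Q, IsSupport p v := by
  refine ⟨⟨⟨{q | 0 < v (toGp Q q)}, fun a b hb => ?_⟩, ⟨fun h => ?_, fun a b h => ?_⟩⟩,
    hv, fun q => Iff.rfl⟩
  · change 0 < v (toGp Q (a + b))
    rw [map_add, map_add]
    exact add_pos_of_nonneg_of_pos (hv a) hb
  · have : (0 : Q) ∈ {q | 0 < v (toGp Q q)} := by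
      rw [show {q | 0 < v (toGp Q q)} = Set.univ from h]
      trivial
    simp at this
  · change 0 < v (toGp Q (a + b)) at h
    change 0 < v (toGp Q a) ∨ 0 < v (toGp Q b)
    rw [map_add, map_add] at h
    by_contra! h'
    linarith

/-- A homomorphism attached to a height one prime is nonnegative on `Q`. -/
theorem IsValuationAt.isSupport {p : Spec Q} {v : GrothendieckAddGroup Q →+ ℤ}
    (hv : IsValuationAt p v) (hp : ∃ q, q ∈ p.1) : IsSupport p v := by
  refine ⟨fun f => ?_, hv.pos_iff⟩
  by_contra! hf
  obtain ⟨q, hq⟩ := hp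
  -- This element lies in `𝔭`, yet its value is `v q * (1 + v f) ≤ 0`.
  have h : q + (v (toGp Q q)).toNat • f ∈ p.1 := (add_mem_iff p _ _).2 (Or.inl hq)
  rw [← hv.pos_iff] at h hq
  rw [map_add, map_add, map_nsmul, map_nsmul, nsmul_eq_mul, Int.toNat_of_nonneg hq.le] at h
  nlinarith

/-! ### Localizations and their separating homomorphisms -/

section Localization

theorem mem_sat_of_nsmul {x : GrothendieckAddGroup Q} {n : ℕ} (hn : 0 < n) {q : Q}
    (h : n • x = toGp Q q) : x ∈ sat Q :=
  ⟨n, hn, q, h.symm⟩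

theorem mem_satLoc_of_nsmul_mem_loc (p : Spec Q) {x : GrothendieckAddGroup Q} {n : ℕ} (hn : 0 < n)
    (h : n • x ∈ loc p) : x ∈ satLoc p := by
  obtain ⟨_, ⟨q, rfl⟩, _, ⟨t, ht, rfl⟩, h⟩ := h
  -- From `n x = q - t` follows `n (x + t) = q + (n - 1) t`.
  refine ⟨x + toGp Q t, mem_sat_of_nsmul hn (q := q + (n - 1) • t) ?_, _, ⟨t, ht, rfl⟩, by abel⟩
  obtain ⟨m, rfl⟩ := Nat.exists_eq_succ_of_ne_zero hn.ne'
  rw [smul_add, h, Nat.succ_sub_one, map_add, map_nsmul, succ_nsmul (toGp Q t)]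
  abel

theorem nonneg_of_mem_satLoc {p : Spec Q} {v : GrothendieckAddGroup Q →+ ℤ} (hv : IsSupport p v)
    {x : GrothendieckAddGroup Q} (hx : x ∈ satLoc p) : 0 ≤ v x := by
  obtain ⟨y, ⟨n, hn, q, hq⟩, _, ⟨t, ht, rfl⟩, rfl⟩ := hx
  have h : 0 ≤ (n : ℤ) * v y := by
    rw [← nsmul_eq_mul, ← map_nsmul, ← hq]
    exact hv.nonneg q
  rw [map_sub, hv.eq_zero ht, sub_zero]
  exact nonneg_of_mul_nonneg_right h (by exact_mod_cast hn)

/-- Otherwise `n t = k + n q` for some `t ∉ 𝔭`, which puts `t` in `𝔭`. Through Farkas this yields a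
homomorphism vanishing off `𝔭` and positive at `q`. -/
theorem neg_notMem_satLoc (hQ : IsFine Q) (p : Spec Q) {q : Q} (hq : q ∈ p.1) :
    -toGp Q q ∉ satLoc p := by
  rintro ⟨y, ⟨n, hn, k, hk⟩, _, ⟨t, ht, rfl⟩, h⟩
  have := hQ.integral
  have hy : y = toGp Q t - toGp Q q := by rw [sub_eq_neg_add, h]; abel
  have : n • t = k + n • q := GrothendieckAddGroup.of_injective <| by
    change toGp Q _ = toGp Q _
    rw [map_add, map_nsmul, map_nsmul, hk, hy, ← smul_add, sub_add_cancel]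
  refine ht ((nsmul_mem_iff p hn t).1 ?_)
  rw [this, add_mem_iff, nsmul_mem_iff p hn]
  exact Or.inr hq

/-- Farkas' lemma for `Q`. -/
theorem IsFine.exists_neg_of_notMem_sat (hQ : IsFine Q) {x : GrothendieckAddGroup Q}
    (hx : x ∉ sat Q) : ∃ v : GrothendieckAddGroup Q →+ ℤ, (∀ q, 0 ≤ v (toGp Q q)) ∧ v x < 0 := by
  have := finite_gp hQ
  obtain ⟨l, hl⟩ := hQ.exists_list
  by_contra! h
  obtain ⟨n, hn, hx'⟩ := exists_nsmul_mem_closure (l.map (toGp Q)) x fun v hv =>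
    h v <| list_induction hl (fun q hq => hv _ (List.mem_map_of_mem hq)) (by simp)
      fun a b ha hb => by rw [map_add, map_add]; exact add_nonneg ha hb
  refine hx ⟨n, hn, AddSubmonoid.closure_le.2 (fun y hy => ?_) hx'⟩
  obtain ⟨q, -, rfl⟩ := List.mem_map.1 hy
  exact ⟨q, rfl⟩

/-- Farkas' lemma for the localization of `Q` at `𝔭`. -/
theorem IsFine.exists_neg_of_notMem_satLoc (hQ : IsFine Q) {p : Spec Q}
    {x : GrothendieckAddGroup Q} (hx : x ∉ satLoc p) :
    ∃ v : GrothendieckAddGroup Q →+ ℤ, (∀ q, 0 ≤ v (toGp Q q)) ∧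
      (∀ q ∉ p.1, v (toGp Q q) = 0) ∧ v x < 0 := by
  classical
  have := finite_gp hQ
  obtain ⟨l, hl⟩ := hQ.exists_list
  by_contra! h
  obtain ⟨n, hn, hx'⟩ := exists_nsmul_mem_closure
    -- Adding the negatives of the generators outside `𝔭` forces vanishing on the face, since these
    -- generators generate it.
    (l.map (toGp Q) ++ (l.filter (· ∉ p.1)).map fun q => -toGp Q q) x fun v hv => by
      have hv0 : ∀ q, 0 ≤ v (toGp Q q) := list_induction hl
        (fun q hq => hv _ (List.mem_append_left _ (List.mem_map_of_mem hq))) (by simp)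
        fun a b ha hb => by rw [map_add, map_add]; exact add_nonneg ha hb
      refine h v hv0 fun q hq => le_antisymm ?_ (hv0 q)
      refine list_induction hl (P := fun q => q ∉ p.1 → v (toGp Q q) ≤ 0) (fun q hq hqp => ?_)
        (by simp) (fun a b ha hb hab => ?_) q hq
      · rw [← neg_nonneg, ← map_neg]
        exact hv _ (List.mem_append_right _ (List.mem_map.2
          ⟨q, List.mem_filter.2 ⟨hq, by simpa using hqp⟩, rfl⟩))
      · rw [add_mem_iff, not_or] at hab
        rw [map_add, map_add]
        exact add_nonpos (ha hab.1) (hb hab.2)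
  refine hx (mem_satLoc_of_nsmul_mem_loc p hn (AddSubmonoid.closure_le.2 (fun y hy => ?_) hx'))
  rcases List.mem_append.1 hy with hy | hy
  · obtain ⟨q, -, rfl⟩ := List.mem_map.1 hy
    exact ⟨_, ⟨q, rfl⟩, 0, zero_mem _, (sub_zero _).symm⟩
  · obtain ⟨q, hq, rfl⟩ := List.mem_map.1 hy
    exact ⟨0, zero_mem _, _, ⟨q, (by simpa using (List.mem_filter.1 hq).2 : q ∉ p.1), rfl⟩, (zero_sub _).symm⟩

/-- Every prime ideal is the set of elements of `Q` on which some homomorphism is positive. -/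
theorem IsFine.exists_isSupport (hQ : IsFine Q) (p : Spec Q) :
    ∃ v : GrothendieckAddGroup Q →+ ℤ, IsSupport p v := by
  obtain ⟨l, hl⟩ := hQ.exists_list
  -- Sum one separating homomorphism for each generator in `𝔭`.
  suffices h : ∀ m : List Q, ∃ v : GrothendieckAddGroup Q →+ ℤ, (∀ q, 0 ≤ v (toGp Q q)) ∧
      (∀ q ∉ p.1, v (toGp Q q) = 0) ∧ ∀ q ∈ m, q ∈ p.1 → 0 < v (toGp Q q) by
    obtain ⟨v, hv, hv0, hvl⟩ := h l
    refine ⟨v, hv, fun q => ⟨fun h => ?_, ?_⟩⟩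
    · by_contra hq
      exact h.ne' (hv0 q hq)
    · refine list_induction hl (P := fun q => q ∈ p.1 → 0 < v (toGp Q q)) hvl
        (fun h => absurd h (zero_notMem p)) (fun a b ha hb hab => ?_) q
      rw [map_add, map_add]
      rcases (add_mem_iff p a b).1 hab with h | h
      · exact add_pos_of_pos_of_nonneg (ha h) (hv b)
      · exact add_pos_of_nonneg_of_pos (hv a) (hb h)
  intro m
  induction m with
  | nil => exact ⟨0, by simp, by simp, by simp⟩
  | cons s m ih =>
    obtain ⟨v, hv, hv0, hvm⟩ := ih
    by_cases hs : s ∈ p.1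
    · obtain ⟨w, hw, hw0, hws⟩ := hQ.exists_neg_of_notMem_satLoc (neg_notMem_satLoc hQ p hs)
      rw [map_neg, neg_lt_zero] at hws
      refine ⟨v + w, fun q => add_nonneg (hv q) (hw q), fun q hq => ?_, fun q hq hqp => ?_⟩
      · rw [AddMonoidHom.add_apply, hv0 q hq, hw0 q hq, add_zero]
      · rcases List.mem_cons.1 hq with rfl | hq
        · exact add_pos_of_nonneg_of_pos (hv _) hws
        · exact add_pos_of_pos_of_nonneg (hvm q hq hqp) (hw q)
    · refine ⟨v, hv, hv0, fun q hq hqp => ?_⟩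
      rcases List.mem_cons.1 hq with rfl | hq
      · exact absurd hqp hs
      · exact hvm q hq hqp

end Localization

/-! ### Minimal ratios and the valuation at a height one prime -/

/-- If `w ≠ 0` and `v` are nonnegative on `Q`, some `v - t w` with `t ≥ 0` rational is nonnegative
on `Q` and vanishes at an element where `w` is positive. -/
theorem IsFine.exists_min_ratio (hQ : IsFine Q) {v w : GrothendieckAddGroup Q →+ ℤ}
    (hv : ∀ q, 0 ≤ v (toGp Q q)) (hw : ∀ q, 0 ≤ w (toGp Q q)) (hw0 : ∃ q, 0 < w (toGp Q q)) :
    ∃ g, 0 < w (toGp Q g) ∧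
      ∀ q, 0 ≤ w (toGp Q g) * v (toGp Q q) - v (toGp Q g) * w (toGp Q q) := by
  classical
  obtain ⟨l, hl⟩ := hQ.exists_list
  have hne : ((l.toFinset).filter fun q => 0 < w (toGp Q q)).Nonempty := by
    by_contra! hne
    obtain ⟨q, hq⟩ := hw0
    refine hq.ne' (list_induction hl (P := fun q => w (toGp Q q) = 0) (fun q hq => ?_) (by simp)
      (fun a b ha hb => ?_) q)
    · refine le_antisymm (not_lt.1 fun h => ?_) (hw q)
      exact Finset.notMem_empty q (hne ▸ Finset.mem_filter.2 ⟨List.mem_toFinset.2 hq, h⟩)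
    · rw [map_add, map_add, ha, hb, add_zero]
  -- The extremal `t` is the least ratio `v g / w g` over generators with `w g > 0`; the conclusion
  -- clears denominators.
  obtain ⟨g, hg, hmin⟩ := Finset.exists_min_image _
    (fun q => (v (toGp Q q) : ℚ) / (w (toGp Q q) : ℚ)) hne
  have hgw := (Finset.mem_filter.1 hg).2
  refine ⟨g, hgw, list_induction hl (P := fun q => 0 ≤ w (toGp Q g) * v (toGp Q q) -
    v (toGp Q g) * w (toGp Q q)) (fun q hq => ?_) ?_ (fun a b ha hb => ?_)⟩
  · rcases (hw q).eq_or_lt with h | h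
    · rw [← h, mul_zero, sub_zero]
      exact mul_nonneg hgw.le (hv q)
    · have := hmin q (Finset.mem_filter.2 ⟨List.mem_toFinset.2 hq, h⟩)
      rw [div_le_div_iff₀ (by exact_mod_cast hgw) (by exact_mod_cast h)] at this
      have : v (toGp Q g) * w (toGp Q q) ≤ v (toGp Q q) * w (toGp Q g) := by exact_mod_cast this
      linarith
  · rw [map_zero, map_zero, map_zero, mul_zero, mul_zero, sub_zero]
  · simp only [map_add]
    linarith

/-- Two nonzero homomorphisms nonnegative on `Q` and vanishing off the same height one prime ideal
are proportional. -/
theorem IsFine.proportional (hQ : IsFine Q) {p : Spec Q} (hp : Order.height p = 1)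
    {v w : GrothendieckAddGroup Q →+ ℤ} (hv : IsSupport p v) (hw : IsSupport p w) :
    ∃ a b : ℤ, 0 < a ∧ 0 < b ∧ ∀ x, a * v x = b * w x := by
  rw [height_eq_one_iff] at hp
  obtain ⟨⟨q₀, hq₀⟩, hp⟩ := hp
  obtain ⟨g, hg, h⟩ := hQ.exists_min_ratio hv.nonneg hw.nonneg ⟨q₀, (hw.pos_iff q₀).2 hq₀⟩
  have hgp := (hw.pos_iff g).1 hg
  have hgv := (hv.pos_iff g).2 hgp
  refine ⟨_, _, hg, hgv, fun x => ?_⟩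
  -- The support of `u` lies in `𝔭` and misses `g ∈ 𝔭`, so by minimality it is empty and `u = 0`.
  let u : GrothendieckAddGroup Q →+ ℤ := w (toGp Q g) • v - v (toGp Q g) • w
  have hu : ∀ x, u x = w (toGp Q g) * v x - v (toGp Q g) * w x := fun x => by simp [u]
  obtain ⟨p', hp'⟩ := MonoidVal.exists_isSupport (v := u) fun q => by rw [hu]; exact h q
  have hle : p' ≤ p := fun q hq => by
    by_contra hqp
    have := (hp'.pos_iff q).2 hq
    rw [hu, hv.eq_zero hqp, hw.eq_zero hqp] at this
    simp at this
  have hemp : ∀ q, q ∉ p'.1 := by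
    intro q hq
    have : g ∈ p'.1 := by rwa [hp p' ⟨q, hq⟩ hle]
    rw [← hp'.pos_iff, hu, mul_comm, sub_self] at this
    exact lt_irrefl _ this
  have : u = 0 := hom_eq_of_toGp fun q => hp'.eq_zero (hemp q)
  rw [← sub_eq_zero, ← hu, this, AddMonoidHom.zero_apply]

theorem IsFine.exists_isValuationAt (hQ : IsFine Q) {p : Spec Q} (hp : Order.height p = 1) :
    ∃ v, IsValuationAt p v := by
  obtain ⟨q, hq⟩ := (height_eq_one_iff.1 hp).1
  obtain ⟨v, hv⟩ := hQ.exists_isSupport p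
  have hv0 : v ≠ 0 := by
    rintro rfl
    exact lt_irrefl _ ((hv.pos_iff q).2 hq)
  obtain ⟨w, d, hd, hw, h⟩ := exists_surjective_mul hv0
  refine ⟨w, hw, fun q => ?_⟩
  rw [← hv.pos_iff, h, mul_pos_iff_of_pos_left hd]

theorem IsFine.isValuationAt_unique (hQ : IsFine Q) {p : Spec Q} (hp : Order.height p = 1)
    {v w : GrothendieckAddGroup Q →+ ℤ} (hv : IsValuationAt p v) (hw : IsValuationAt p w) :
    v = w := by
  have hne := (height_eq_one_iff.1 hp).1
  obtain ⟨a, b, ha, hb, h⟩ := hQ.proportional hp (hv.isSupport hne) (hw.isSupport hne)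
  obtain ⟨x, hx⟩ := hv.surjective 1
  obtain ⟨y, hy⟩ := hw.surjective 1
  have hab : a = b := by
    -- Evaluating `a v = b w` where `w` or `v` equals `1` gives the two divisibilities.
    refine Int.dvd_antisymm ha.le hb.le ⟨v y, ?_⟩ ⟨w x, ?_⟩
    · rw [h, hy, mul_one]
    · rw [← h, hx, mul_one]
  ext z
  exact mul_left_cancel₀ ha.ne' (by rw [h, hab])

theorem IsFine.satLoc_eq (hQ : IsFine Q) {p : Spec Q} (hp : Order.height p = 1)
    {v : GrothendieckAddGroup Q →+ ℤ} (hv : IsValuationAt p v) :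
    (satLoc p : Set (GrothendieckAddGroup Q)) = {x | 0 ≤ v x} := by
  have hsupp := hv.isSupport (height_eq_one_iff.1 hp).1
  refine Set.Subset.antisymm (fun x hx => nonneg_of_mem_satLoc hsupp hx) fun x hx => ?_
  by_contra hx'
  obtain ⟨w, hw, hw0, hwx⟩ := hQ.exists_neg_of_notMem_satLoc hx'
  obtain ⟨p', hp'⟩ := MonoidVal.exists_isSupport hw
  have hle : p' ≤ p := fun q hq => by
    by_contra hqp
    exact ((hp'.pos_iff q).2 hq).ne' (hw0 q hqp)
  have hne : ∃ q, q ∈ p'.1 := by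
    by_contra! hemp
    have : w = 0 := hom_eq_of_toGp fun q => hp'.eq_zero (hemp q)
    simp [this] at hwx
  obtain rfl := (height_eq_one_iff.1 hp).2 p' hne hle
  obtain ⟨a, b, ha, hb, h⟩ := hQ.proportional hp hsupp hp'
  have hx : 0 ≤ v x := hx
  nlinarith [h x, mul_nonneg ha.le hx, mul_neg_of_pos_of_neg hb hwx]

/-- Elements of the abstract group `M^gp` are differences of elements of `M`, and the sign of `v` on
the corresponding difference in `G` decides which of it and its negative lies in `M`. -/
theorem isValuative_of_eq_nonneg {G : Type*} [AddCommGroup G] (M : AddSubmonoid G) (v : G →+ ℤ)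
    (h : (M : Set G) = {x | 0 ≤ v x}) : IsValuative M := by
  have hM : ∀ x, 0 ≤ v x → x ∈ M := fun x hx => by
    rw [← SetLike.mem_coe, h]
    exact hx
  have key : ∀ a b : M, 0 ≤ v (a - b : G) → toGp M a - toGp M b ∈ inGp M := fun a b hab => by
    refine ⟨⟨(a : G) - b, hM _ hab⟩, ?_⟩
    rw [eq_sub_iff_add_eq, ← map_add]
    exact congrArg _ (Subtype.ext (sub_add_cancel (a : G) b))
  refine ⟨inferInstance, fun x => ?_⟩
  obtain ⟨a, b, rfl⟩ := exists_eq_toGp_sub x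
  rw [neg_sub]
  refine (le_total 0 (v (a - b : G))).imp (key a b) fun hab => key b a ?_
  rw [← neg_sub, map_neg]
  exact neg_nonneg.2 hab

/-! ### Descent to height one and the saturated case -/

/-- If a homomorphism nonnegative on `Q` is negative at `x`, so is one whose support is a prime
ideal of height one. -/
theorem IsFine.exists_heightOne_neg (hQ : IsFine Q) (x : GrothendieckAddGroup Q) (p : Spec Q)
    (v : GrothendieckAddGroup Q →+ ℤ) (hv : IsSupport p v) (hx : v x < 0) :
    ∃ (p' : Spec Q) (w : GrothendieckAddGroup Q →+ ℤ),
      Order.height p' = 1 ∧ IsSupport p' w ∧ w x < 0 := by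
  have := hQ.finite_spec
  induction p using WellFoundedLT.induction generalizing v with
  | ind p ih =>
  by_cases hp : Order.height p = 1
  · exact ⟨p, v, hp, hv, hx⟩
  have hne : ∃ q, q ∈ p.1 := by
    by_contra! hemp
    have : v = 0 := hom_eq_of_toGp fun q => hv.eq_zero (hemp q)
    simp [this] at hx
  rw [height_eq_one_iff, not_and] at hp
  have hp := hp hne
  push Not at hp
  obtain ⟨p₁, ⟨q₁, hq₁⟩, hle, hp₁⟩ := hp
  obtain ⟨w, hw⟩ := hQ.exists_isSupport p₁
  by_cases hwx : w x < 0
  · exact ih p₁ (lt_of_le_of_ne hle hp₁) w hw hwx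
  obtain ⟨g, hg, h⟩ := hQ.exists_min_ratio hv.nonneg hw.nonneg ⟨q₁, (hw.pos_iff q₁).2 hq₁⟩
  have hgp : g ∈ p.1 := hle ((hw.pos_iff g).1 hg)
  -- As `w x ≥ 0`, subtracting a multiple of `w` keeps the value at `x` negative, while `g` leaves
  -- the support.
  let u : GrothendieckAddGroup Q →+ ℤ := w (toGp Q g) • v - v (toGp Q g) • w
  have hu : ∀ x, u x = w (toGp Q g) * v x - v (toGp Q g) * w x := fun x => by simp [u]
  obtain ⟨p₂, hp₂⟩ := MonoidVal.exists_isSupport (v := u) fun q => by rw [hu]; exact h q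
  have hlt : p₂ < p := by
    refine lt_of_le_of_ne (fun q hq => ?_) ?_
    · by_contra hqp
      have := (hp₂.pos_iff q).2 hq
      rw [hu, hv.eq_zero hqp, hw.eq_zero fun h => hqp (hle h)] at this
      simp at this
    · rintro rfl
      rw [← hp₂.pos_iff, hu, mul_comm, sub_self] at hgp
      exact lt_irrefl _ hgp
  refine ih p₂ hlt u hp₂ ?_
  rw [hu]
  have h₁ := mul_neg_of_pos_of_neg hg hx
  have h₂ := mul_nonneg (hv.nonneg g) (not_lt.1 hwx)
  linarith

/-- A saturated fine monoid is cut out by the valuations at its height one prime ideals. -/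
theorem IsFine.range_toGp_eq (hQ : IsFine Q) (hs : IsSaturated Q)
    (v : HeightOne Q → (GrothendieckAddGroup Q →+ ℤ)) (hv : ∀ p, IsValuationAt p.1 (v p)) :
    Set.range (toGp Q) = {x | ∀ p, 0 ≤ v p x} := by
  refine Set.Subset.antisymm ?_ fun x hx => ?_
  · rintro _ ⟨q, rfl⟩ p
    exact ((hv p).isSupport (height_eq_one_iff.1 p.2).1).nonneg q
  · by_contra hxQ
    have hsat : x ∉ sat Q := fun ⟨n, hn, h⟩ => hxQ (hs.saturated x n hn h)
    obtain ⟨w, hw, hwx⟩ := hQ.exists_neg_of_notMem_sat hsat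
    obtain ⟨p, hp⟩ := MonoidVal.exists_isSupport hw
    obtain ⟨p', u, hp', hu, hux⟩ := hQ.exists_heightOne_neg x p w hp hwx
    obtain ⟨a, b, ha, hb, h⟩ := hQ.proportional hp'
      ((hv ⟨p', hp'⟩).isSupport (height_eq_one_iff.1 hp').1) hu
    nlinarith [h x, mul_nonneg ha.le (hx ⟨p', hp'⟩), mul_neg_of_pos_of_neg hb hux]

theorem IsFine.isAddUnit_image_eq (hQ : IsFine Q) (hs : IsSaturated Q)
    (v : HeightOne Q → (GrothendieckAddGroup Q →+ ℤ)) (hv : ∀ p, IsValuationAt p.1 (v p)) :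
    toGp Q '' {q | IsAddUnit q} = {x | ∀ p, v p x = 0} := by
  have hr := hQ.range_toGp_eq hs v hv
  refine Set.Subset.antisymm ?_ fun x hx => ?_
  · rintro _ ⟨q, hq, rfl⟩ p
    obtain ⟨k, hk⟩ := hq.exists_neg
    have h0 := ((hv p).isSupport (height_eq_one_iff.1 p.2).1).nonneg
    have h := h0 k
    rw [eq_neg_of_add_eq_zero_right (by rw [← map_add, hk, map_zero] :
      toGp Q q + toGp Q k = 0), map_neg, neg_nonneg] at h
    exact le_antisymm h (h0 q)
  · obtain ⟨q, rfl⟩ : x ∈ Set.range (toGp Q) := hr ▸ fun p => (hx p).ge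
    obtain ⟨k, hk⟩ : -toGp Q q ∈ Set.range (toGp Q) := hr ▸ fun p => by
      rw [map_neg, hx p, neg_zero]
    have := hQ.integral
    refine ⟨q, IsAddUnit.of_add_eq_zero k (GrothendieckAddGroup.of_injective ?_), rfl⟩
    change toGp Q _ = toGp Q _
    rw [map_add, hk, add_neg_cancel, map_zero]

theorem IsFine.range_toGp_eq_iInter_loc (hQ : IsFine Q) (hs : IsSaturated Q) :
    Set.range (toGp Q) = ⋂ p : HeightOne Q, (loc p.1 : Set (GrothendieckAddGroup Q)) := by
  choose v hv using fun p : HeightOne Q => hQ.exists_isValuationAt p.2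
  refine Set.Subset.antisymm ?_ fun x hx => ?_
  · rintro _ ⟨q, rfl⟩
    exact Set.mem_iInter.2 fun p => ⟨_, ⟨q, rfl⟩, 0, zero_mem _, (sub_zero _).symm⟩
  · rw [hQ.range_toGp_eq hs v hv]
    intro p
    refine nonneg_of_mem_satLoc ((hv p).isSupport (height_eq_one_iff.1 p.2).1) ?_
    -- Taking `n = 1` gives `Q_𝔭 ⊆ Q^sat_𝔭`.
    refine mem_satLoc_of_nsmul_mem_loc p.1 one_pos ?_
    rw [one_smul]
    exact Set.mem_iInter.1 hx p

end Monoid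

end MonoidVal

theorem mainTheorem8 (Q : Type*) [AddCommMonoid Q] (hQ : MonoidVal.IsFine Q) :
    -- the valuation attached to a prime ideal of height one
    (∀ p : MonoidVal.HeightOne Q,
      MonoidVal.IsValuative (MonoidVal.satLoc p.1) ∧
      (∃! v : Algebra.GrothendieckAddGroup Q →+ ℤ, MonoidVal.IsValuationAt p.1 v) ∧
      (∀ v : Algebra.GrothendieckAddGroup Q →+ ℤ, MonoidVal.IsValuationAt p.1 v →
        (MonoidVal.satLoc p.1 : Set (Algebra.GrothendieckAddGroup Q)) = {x | 0 ≤ v x})) ∧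
    -- the description of `Q` and of its units when `Q` is saturated
    (MonoidVal.IsSaturated Q →
      (∀ v : MonoidVal.HeightOne Q → (Algebra.GrothendieckAddGroup Q →+ ℤ),
        (∀ p : MonoidVal.HeightOne Q, MonoidVal.IsValuationAt p.1 (v p)) →
        Set.range (MonoidVal.toGp Q) = {x | ∀ p : MonoidVal.HeightOne Q, 0 ≤ v p x} ∧
        MonoidVal.toGp Q '' {q | IsAddUnit q} =
          {x | ∀ p : MonoidVal.HeightOne Q, v p x = 0}) ∧
      Set.range (MonoidVal.toGp Q) =
        ⋂ p : MonoidVal.HeightOne Q,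
          (MonoidVal.loc p.1 : Set (Algebra.GrothendieckAddGroup Q))) := by
  refine ⟨fun p => ?_, fun hs => ⟨fun v hv => ?_, hQ.range_toGp_eq_iInter_loc hs⟩⟩
  · obtain ⟨v, hv⟩ := hQ.exists_isValuationAt p.2
    exact ⟨MonoidVal.isValuative_of_eq_nonneg _ v (hQ.satLoc_eq p.2 hv),
      ⟨v, hv, fun w hw => hQ.isValuationAt_unique p.2 hw hv⟩, fun w hw => hQ.satLoc_eq p.2 hw⟩
  · exact ⟨hQ.range_toGp_eq hs v hv, hQ.isAddUnit_image_eq hs v hv⟩
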